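/- Let $n\ge 1$ be an integer, $s\in\mathbb{C}$ and $\lambda\in\{1,-1\}$. Powers of complex numbers in $\mathbb{C}\setminus(-\infty,0]$ are taken with the principal branch. A solution of the Lewis equation for $\mathrm{PSL}(2,\mathbb{Z})$ of weight $s$ is a function $\phi$, holomorphic in $\mathbb{C}\setminus(-\infty,0]$, such that for all $z$ in this domain $$\phi(z)=\phi(z+1)+\lambda z^{-2s}\phi\left(1+\tfrac1z\right).$$ For an integer matrix $A=\begin{pmatrix}a&b\\c&d\end{pmatrix}$ put $(\phi|_sA)(z)=|\det A|^s(cz+d)^{-2s}\phi\left(\frac{az+b}{cz+d}\right)$, and extend this linearly to finite formal sums of matrices. Let $$S_n=\left\{\begin{pmatrix}a&b\\c&d\end{pmatrix}: a,b,c,d\in\mathbb{Z},\ a>c\ge0,\ d>b\ge0,\ ad-bc=n\right\},\qquad \tilde T_n=\sum_{A\in S_n,\ \gcd(a,b,c,d)=1}A,$$ where the sum is a formal one. The operator $\tilde H_n$ is defined as follows. Call $(x,y),(x',y')\in\mathbb{Z}^2$ equivalent if there is $k\in\mathbb{Z}$ with $\gcd(k,n)=1$, $kx\equiv x'$ and $ky\equiv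 y'\pmod n$; let $[x:y]$ be the class of $(x,y)$, and let $I_n$ be the set of the classes $[x:y]$ of the lower rows $(x,y)$ of the matrices in $\mathrm{GL}(2,\mathbb{Z})$. Let $P_n$ be the set of pairs $(c,b)$ of integers with $c\ge1$, $c\mid n$, $0\le b<\frac nc$ for which there is $k\in\{0,\dots,c-1\}$ with $\gcd(c,b+k\frac nc)=1$, and let $d(c,b)$ be the minimum of $c+b+k\frac nc$ over all such $k$. The map $(c,b)\mapsto[c:d(c,b)]$ is a bijection from $P_n$ to $I_n$; if $i\in I_n$ corresponds to $(c,b)$, put $A_i=\begin{pmatrix}c&b\\0&n/c\end{pmatrix}$. Let $Y_n=\left\{\begin{pmatrix}c&0\\a&n/c\end{pmatrix}: c\ge1,\ c\mid n,\ 0\le a<c\right\}\subseteq S_n$, and for $\begin{pmatrix}a&b\\c&d\end{pmatrix}\in S_n\setminus Y_n$ let $$K\begin{pmatrix}a&b\\c&d\end{pmatrix}=\begin{pmatrix}-c+ma&-d+mb\\a&b\end{pmatrix}\in S_n,\qquad m=\left\lceil\tfrac db\right\rceil .$$ For $i\in I_n$ let $k_i$ be the least $k\ge0$ with $K^k(A_i)\in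 Y_n$ (it exists), and put $\tilde\psi_i=\sum_{j=0}^{k_i}K^j(A_i)$ and $\tilde H_n\phi=\sum_{i\in I_n}\phi|_s\tilde\psi_i$. **Theorem.** For every solution $\phi$ of the Lewis equation of weight $s$ one has $\tilde H_n\phi=\phi|_s\tilde T_n$ on $\mathbb{C}\setminus(-\infty,0]$, and the function $\tilde\phi=\phi|_s\tilde T_n$ is again a solution of the Lewis equation, with the same $\lambda$ and the same weight $s$. -/

import Mathlib

open Complex

noncomputable section

/-- The (scalar) Lewis equation `φ(z) = φ(z+1) + lam * z^(-2s) * φ(1 + 1/z)` of weight `s`, for a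
function holomorphic in the cut plane `ℂ ∖ (-∞, 0]`. Powers are taken with the principal branch.
The values of `φ` outside the cut plane are irrelevant. -/
structure IsLewisSolution (lam s : ℂ) (φ : ℂ → ℂ) : Prop where
  holomorphic : DifferentiableOn ℂ φ slitPlane
  equation : ∀ z ∈ slitPlane, φ z = φ (z + 1) + lam * z ^ (-2 * s) * φ (1 + 1 / z)

/-- Integer two by two matrices. -/
abbrev IntMat : Type := Matrix (Fin 2) (Fin 2) ℤ

/-- The slash operation of complex weight `s`:
`(φ ∣ₛ A)(z) = |det A|^s (c z + d)^(-2s) φ((a z + b) / (c z + d))`. -/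
def slash (s : ℂ) (φ : ℂ → ℂ) (A : IntMat) (z : ℂ) : ℂ :=
  ((|A.det| : ℤ) : ℂ) ^ s * ((A 1 0 : ℂ) * z + (A 1 1 : ℂ)) ^ (-2 * s) *
    φ (((A 0 0 : ℂ) * z + (A 0 1 : ℂ)) / ((A 1 0 : ℂ) * z + (A 1 1 : ℂ)))

/-- The slash operation extended by linearity to finite formal sums of matrices with integer
coefficients. -/
def slashSum (s : ℂ) (φ : ℂ → ℂ) (R : IntMat →₀ ℤ) (z : ℂ) : ℂ :=
  R.sum fun A m => (m : ℂ) * slash s φ A z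

/-- The set `S_n` of integer matrices with `a > c ≥ 0`, `d > b ≥ 0` and `ad - bc = n`. -/
def matS (n : ℕ) : Set IntMat :=
  {A | A 1 0 < A 0 0 ∧ 0 ≤ A 1 0 ∧ A 0 1 < A 1 1 ∧ 0 ≤ A 0 1 ∧
    A 0 0 * A 1 1 - A 0 1 * A 1 0 = n}

/-- A matrix is primitive if the greatest common divisor of its four entries is `1`. -/
def IsPrimitiveMat (A : IntMat) : Prop :=
  Nat.gcd (Int.gcd (A 0 0) (A 0 1)) (Int.gcd (A 1 0) (A 1 1)) = 1

theorem matS_finite (n : ℕ) : (matS n).Finite := by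
  refine (Set.Finite.pi' fun _ : Fin 2 => Set.Finite.pi' fun _ : Fin 2 =>
    Set.finite_Icc (0 : ℤ) n).subset ?_
  rintro A ⟨h1, h2, h3, h4, h5⟩ i j
  have ha : A 0 0 ≤ n := by nlinarith
  have hd : A 1 1 ≤ n := by nlinarith
  fin_cases i <;> fin_cases j <;> simp <;> omega

theorem primitive_finite (n : ℕ) : {A ∈ matS n | IsPrimitiveMat A}.Finite :=
  (matS_finite n).subset fun _ h => h.1

/-- `T̃_n`: the formal sum of all primitive matrices in `S_n`. -/
def tildeT (n : ℕ) : IntMat →₀ ℤ :=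
  ∑ A ∈ (primitive_finite n).toFinset, Finsupp.single A 1

/-- The relation `(x, y) ∼ (k x, k y)` modulo `n`, for `k` prime to `n`, on `ℤ × ℤ`. -/
def pointSetoid (n : ℕ) : Setoid (ℤ × ℤ) where
  r p q := ∃ k : ℤ, Int.gcd k n = 1 ∧ k * p.1 ≡ q.1 [ZMOD n] ∧ k * p.2 ≡ q.2 [ZMOD n]
  iseqv := by
    refine ⟨fun p => ⟨1, by simp, by simp, by simp⟩, ?_, ?_⟩
    · rintro p q ⟨k, hk, h1, h2⟩
      obtain ⟨u, v, huv⟩ := Int.isCoprime_iff_gcd_eq_one.2 hk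
      have hu : u * k ≡ 1 [ZMOD n] := by
        rw [← huv]
        simp [Int.ModEq]
      refine ⟨u, Int.isCoprime_iff_gcd_eq_one.1 ⟨k, v, by linarith⟩, ?_, ?_⟩
      · have := (h1.mul_left u).symm.trans (by simpa [mul_assoc] using hu.mul_right p.1)
        exact this
      · have := (h2.mul_left u).symm.trans (by simpa [mul_assoc] using hu.mul_right p.2)
        exact this
    · rintro p q r ⟨k, hk, h1, h2⟩ ⟨l, hl, h3, h4⟩
      refine ⟨l * k, ?_, ?_, ?_⟩
      · exact Int.isCoprime_iff_gcd_eq_one.1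
          ((Int.isCoprime_iff_gcd_eq_one.2 hl).mul_left (Int.isCoprime_iff_gcd_eq_one.2 hk))
      · rw [mul_assoc]
        exact (h1.mul_left l).trans h3
      · rw [mul_assoc]
        exact (h2.mul_left l).trans h4

/-- The set of all points `[x : y]` modulo `n`, on which `GL(2,ℤ)` acts from the right. -/
abbrev PointSpace (n : ℕ) : Type := Quotient (pointSetoid n)

/-- The point `[x : y]`. -/
def point (n : ℕ) (x y : ℤ) : PointSpace n := Quotient.mk (pointSetoid n) (x, y)

/-- The index set `I_n`: the orbit of `[0 : 1]` under `GL(2,ℤ)`. The stabilizer of `[0 : 1]` is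
the group of the matrices in `GL(2,ℤ)` with lower left entry divisible by `n`, so that `I_n` is the
space of its right cosets; the coset of `g` corresponds to the lower row of `g`. -/
def indexSet (n : ℕ) : Set (PointSpace n) :=
  Set.range fun g : GL (Fin 2) ℤ => point n (g.1 1 0) (g.1 1 1)

/-- The set `P_n` of pairs `(c, b)` with `c ≥ 1`, `c ∣ n`, `0 ≤ b < n / c` that are
`n`-admissible. -/
def pairSet (n : ℕ) : Set (ℕ × ℕ) :=
  {p | 1 ≤ p.1 ∧ p.1 ∣ n ∧ p.2 < n / p.1 ∧ ∃ k < p.1, Nat.gcd p.1 (p.2 + k * (n / p.1)) = 1}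

/-- The number `d(c, b)`: the least `c + b + k n / c` with `0 ≤ k < c` and
`gcd(c, b + k n / c) = 1`. -/
def pairD (n : ℕ) (p : ℕ × ℕ) : ℕ :=
  sInf {d | ∃ k < p.1, Nat.gcd p.1 (p.2 + k * (n / p.1)) = 1 ∧ d = p.1 + p.2 + k * (n / p.1)}

/-- The map `(c, b) ↦ [c : d(c, b)]`, which parametrizes `I_n` by `P_n`. -/
def pairPoint (n : ℕ) (p : ℕ × ℕ) : PointSpace n := point n p.1 (pairD n p)

/-- The pair `(c, b)` in `P_n` that belongs to an index in `I_n`. -/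
def indexPair (n : ℕ) (i : PointSpace n) : ℕ × ℕ := Function.invFunOn (pairPoint n) (pairSet n) i

/-- The upper triangular matrix `A_i` with rows `(c, b)` and `(0, n / c)`. -/
def matA (n : ℕ) (i : PointSpace n) : IntMat :=
  !![((indexPair n i).1 : ℤ), ((indexPair n i).2 : ℤ); 0, ((n / (indexPair n i).1 : ℕ) : ℤ)]

/-- The set `Y_n` of matrices with rows `(c, 0)` and `(a, n / c)`, where `c ∣ n` and
`0 ≤ a < c`. -/
def matY (n : ℕ) : Set IntMat :=
  {A | ∃ c a : ℕ, c ∣ n ∧ a < c ∧ A = !![(c : ℤ), 0; (a : ℤ), ((n / c : ℕ) : ℤ)]}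

/-- The map `K`, which sends the matrix with rows `(a, b)`, `(c, d)` to the one with rows
`(-c + m a, -d + m b)`, `(a, b)`, where `m = ⌈d / b⌉`. It is only applied to elements of `S_n`
outside `Y_n`, and these have `b > 0`. -/
def mapK (A : IntMat) : IntMat :=
  let m : ℤ := ⌈(A 1 1 : ℚ) / (A 0 1 : ℚ)⌉
  !![-(A 1 0) + m * A 0 0, -(A 1 1) + m * A 0 1; A 0 0, A 0 1]

/-- The number `k_i`: the iteration of `K` that starts with `A_i` stops as soon as it reaches an
element of `Y_n`, and this happens after `k_i` steps. -/
def chainLength (n : ℕ) (i : PointSpace n) : ℕ := sInf {k | mapK^[k] (matA n i) ∈ matY n}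

/-- The formal sum `ψ̃_i` of the matrices in the chain `A_i, K(A_i), …, K^{k_i}(A_i)`. -/
def tildePsi (n : ℕ) (i : PointSpace n) : IntMat →₀ ℤ :=
  ∑ j ∈ Finset.range (chainLength n i + 1), Finsupp.single (mapK^[j] (matA n i)) 1

/-- The operator `H̃_n`: the sum of the components `φ ∣ₛ ψ̃_i`, `i ∈ I_n`. -/
def tildeH (n : ℕ) (s : ℂ) (φ : ℂ → ℂ) (z : ℂ) : ℂ :=
  ∑ᶠ i ∈ indexSet n, slashSum s φ (tildePsi n i) z

/-- The index set is finite, so that the sum over it is an ordinary finite sum. -/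
theorem indexSet_finite (n : ℕ) (hn : 0 < n) : (indexSet n).Finite := by
  refine ((Set.finite_Icc (0 : ℤ) n).prod (Set.finite_Icc (0 : ℤ) n)
    |>.image fun p => point n p.1 p.2).subset ?_
  rintro _ ⟨g, rfl⟩
  have h : (0 : ℤ) < n := by exact_mod_cast hn
  refine ⟨(g.1 1 0 % n, g.1 1 1 % n), ⟨⟨Int.emod_nonneg _ h.ne', (Int.emod_lt_of_pos _ h).le⟩,
    ⟨Int.emod_nonneg _ h.ne', (Int.emod_lt_of_pos _ h).le⟩⟩, ?_⟩
  exact Quotient.sound ⟨1, by simp, by simp [Int.ModEq], by simp [Int.ModEq]⟩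

end

/-! Matrices with nonnegative entries map the cut plane to itself, and on them the slash operation
satisfies `φ|(CB) = (φ|C)|B`. Put U = (1,1;0,1), V = (1,0;1,1), M = (0,1;1,0). A solution satisfies
`λ φ|M = φ`, and the Lewis equation becomes `φ|(1 - U - V) = 0`.

Let S be the set of primitive matrices in `S_n`, S' the set of their transposes, and N the generally
infinite set of primitive nonnegative matrices of determinant n. Two rows of an element of N are
either comparable entrywise, so that U⁻¹ or V⁻¹ can be split off on the left within N, or they are
incomparable, which means membership in S. Hence S = (1 - U - V)N and, transposing, S' = N(1 - U -
V), as identities of indicator functions. Therefore S(1 - U - V) = (1 - U - V)S' (`ind_mul_comm`,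
`sum_primS_sub`). Since φ kills the right side, `φ|S` satisfies the three-term equation; symmetry of
S under conjugation by M restores the original form.

The equality of the operators is one of formal sums. K maps the elements of S with b ≠ 0 bijectively
to those with c ≠ 0; it lowers b, and its inverse lowers c. So S is the disjoint union of the chains
that start at its upper triangular elements (`sum_chains`). These elements are exactly the `A_i`
(`matA_bijOn`), since a pair (c, b) is admissible exactly when its triangular matrix is primitive.
-/

/-! ### The slash action of nonnegative matrices on the cut plane. -/

/-- The matrices with nonnegative entries and nonzero determinant. -/
structure IsNonnegMat (A : IntMat) : Prop where
  nonneg : ∀ i j, 0 ≤ A i j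
  det_ne : A.det ≠ 0

/-- The denominator `c z + d`. -/
def moebiusDen (A : IntMat) (z : ℂ) : ℂ := (A 1 0 : ℂ) * z + (A 1 1 : ℂ)

/-- The fractional linear action of a matrix. -/
noncomputable def moebius (A : IntMat) (z : ℂ) : ℂ :=
  ((A 0 0 : ℂ) * z + (A 0 1 : ℂ)) / moebiusDen A z

theorem slash_eq (s : ℂ) (φ : ℂ → ℂ) (A : IntMat) (z : ℂ) :
    slash s φ A z =
      ((|A.det| : ℤ) : ℂ) ^ s * moebiusDen A z ^ (-2 * s) * φ (moebius A z) := rfl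

/-- The arguments of `x * y` and of the factors differ by 2πk. If k ≠ 0, the arguments of x and y
add up past ±π, so y and `x * y` lie in opposite open half planes, which the sign conditions
exclude. -/
theorem mul_cpow_of_im {x y : ℂ} (hx : x ∈ slitPlane) (hy : y ∈ slitPlane)
    (hxy : x * y ∈ slitPlane) (h1 : 0 < y.im → 0 ≤ (x * y).im) (h2 : y.im < 0 → (x * y).im ≤ 0)
    (r : ℂ) : (x * y) ^ r = x ^ r * y ^ r := by
  have hx0 := slitPlane_ne_zero hx
  have hy0 := slitPlane_ne_zero hy
  have ltpi : ∀ {w : ℂ}, w ∈ slitPlane → arg w < Real.pi := fun hw =>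
    lt_of_le_of_ne (arg_le_pi _) (mem_slitPlane_iff_arg.1 hw).1
  have ax := ltpi hx
  have ay := ltpi hy
  have axy := ltpi hxy
  have bx := neg_pi_lt_arg x
  have by' := neg_pi_lt_arg y
  have bxy := neg_pi_lt_arg (x * y)
  have key : arg (x * y) = arg x + arg y := by
    have h := arg_mul_coe_angle hx0 hy0
    rw [← Real.Angle.coe_add, Real.Angle.angle_eq_iff_two_pi_dvd_sub] at h
    obtain ⟨k, hk⟩ := h
    rcases lt_trichotomy k 0 with h | h | h
    · have : (k : ℝ) ≤ -1 := by exact_mod_cast (by omega : k ≤ -1)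
      have hm : 2 * Real.pi * k ≤ 2 * Real.pi * (-1) :=
        mul_le_mul_of_nonneg_left this (by positivity)
      have i1 : 0 ≤ (x * y).im := h1 <| by
        by_contra! hn
        rcases hn.lt_or_eq with hn | hn
        · have := arg_neg_iff.2 hn
          linarith
        · have : arg y = 0 := arg_eq_zero_iff.2 ⟨by
            rcases hy with h | h
            · exact h.le
            · exact absurd hn h, hn⟩
          linarith
      have := arg_nonneg_iff.2 i1
      linarith
    · simp [h] at hk
      linarith
    · have : (1 : ℝ) ≤ k := by exact_mod_cast (by omega : 1 ≤ k)
      have hm : 2 * Real.pi * 1 ≤ 2 * Real.pi * k :=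
        mul_le_mul_of_nonneg_left this (by positivity)
      have i1 : (x * y).im ≤ 0 := h2 <| arg_neg_iff.1 (by linarith)
      rcases i1.lt_or_eq with hn | hn
      · have := arg_neg_iff.2 hn
        linarith
      · have : arg (x * y) = 0 := arg_eq_zero_iff.2 ⟨by
            rcases hxy with h | h
            · exact h.le
            · exact absurd hn h, hn⟩
        linarith
  have hl : log (x * y) = log x + log y :=
    (log_mul_eq_add_log_iff hx0 hy0).2 (by rw [← key]; exact ⟨bxy, axy.le⟩)
  rw [cpow_def_of_ne_zero (mul_ne_zero hx0 hy0), cpow_def_of_ne_zero hx0,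
    cpow_def_of_ne_zero hy0, hl, add_mul, exp_add]

theorem real_linear_mem_slitPlane {p q : ℝ} (hp : 0 ≤ p) (hq : 0 ≤ q) (h : p ≠ 0 ∨ q ≠ 0)
    {z : ℂ} (hz : z ∈ slitPlane) : (p : ℂ) * z + (q : ℂ) ∈ slitPlane := by
  rw [mem_slitPlane_iff] at hz ⊢
  simp only [add_re, mul_re, ofReal_re, ofReal_im, zero_mul, sub_zero, add_im, mul_im, add_zero]
  rcases hp.eq_or_lt with rfl | hp'
  · left
    have : 0 < q := lt_of_le_of_ne hq (by simpa [eq_comm] using h)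
    simpa using this
  · rcases hz with hz | hz
    · left
      positivity
    · right
      positivity

namespace IsNonnegMat

variable {A B C : IntMat}

theorem mul (hA : IsNonnegMat A) (hB : IsNonnegMat B) : IsNonnegMat (A * B) where
  nonneg i j := by
    rw [Matrix.mul_apply]
    exact Finset.sum_nonneg fun k _ => mul_nonneg (hA.nonneg _ _) (hB.nonneg _ _)
  det_ne := by
    rw [Matrix.det_mul]
    exact mul_ne_zero hA.det_ne hB.det_ne

theorem row_ne (hA : IsNonnegMat A) (i : Fin 2) : A i 0 ≠ 0 ∨ A i 1 ≠ 0 := by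
  have h := hA.det_ne
  rw [Matrix.det_fin_two] at h
  by_contra! hc
  fin_cases i <;> simp_all

theorem linear_mem (hA : IsNonnegMat A) (i : Fin 2) {z : ℂ} (hz : z ∈ slitPlane) :
    (A i 0 : ℂ) * z + (A i 1 : ℂ) ∈ slitPlane := by
  have := real_linear_mem_slitPlane (p := A i 0) (q := A i 1) (by exact_mod_cast hA.nonneg i 0)
    (by exact_mod_cast hA.nonneg i 1) (by exact_mod_cast hA.row_ne i) hz
  simpa using this

theorem den_mem (hA : IsNonnegMat A) {z : ℂ} (hz : z ∈ slitPlane) :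
    moebiusDen A z ∈ slitPlane := hA.linear_mem 1 hz

/-- A value -t with t ≥ 0 would give (a + tc)z + (b + td) = 0, but a nonnegative nonzero linear form
does not vanish on the cut plane. -/
theorem moebius_mem (hA : IsNonnegMat A) {z : ℂ} (hz : z ∈ slitPlane) :
    moebius A z ∈ slitPlane := by
  have hd := slitPlane_ne_zero (hA.den_mem hz)
  rw [mem_slitPlane_iff_not_le_zero]
  intro hle
  obtain ⟨h1, h2⟩ := Complex.le_def.1 hle
  simp only [zero_re, zero_im] at h1 h2
  set t : ℝ := -(moebius A z).re with ht
  have hw : moebius A z = -(t : ℂ) := by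
    apply Complex.ext <;> simp [ht, h2]
  have ht0 : 0 ≤ t := by linarith
  rw [moebius, div_eq_iff hd, moebiusDen] at hw
  have c : ∀ i j, (0 : ℝ) ≤ A i j := fun i j => by exact_mod_cast hA.nonneg i j
  have hm := real_linear_mem_slitPlane (p := A 0 0 + t * A 1 0) (q := A 0 1 + t * A 1 1)
    (by have := c 0 0; have := c 1 0; positivity) (by have := c 0 1; have := c 1 1; positivity)
    (by
      have h0 := mul_nonneg ht0 (c 1 0)
      have h1 := mul_nonneg ht0 (c 1 1)
      have := c 0 0
      have := c 0 1
      rcases hA.row_ne 0 with h | h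
      · left
        have : (A 0 0 : ℝ) ≠ 0 := by exact_mod_cast h
        positivity
      · right
        have : (A 0 1 : ℝ) ≠ 0 := by exact_mod_cast h
        positivity) hz
  refine slitPlane_ne_zero hm ?_
  push_cast
  linear_combination hw

theorem den_mul (hB : IsNonnegMat B) {z : ℂ} (hz : z ∈ slitPlane) :
    moebiusDen (C * B) z = moebiusDen C (moebius B z) * moebiusDen B z := by
  have hd := slitPlane_ne_zero (hB.den_mem hz)
  have hn : moebius B z * moebiusDen B z = (B 0 0 : ℂ) * z + (B 0 1 : ℂ) := div_mul_cancel₀ _ hd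
  rw [moebiusDen.eq_1 C, add_mul, mul_assoc, hn]
  simp only [moebiusDen, Matrix.mul_apply, Fin.sum_univ_two]
  push_cast
  ring

theorem moebius_mul (hC : IsNonnegMat C) (hB : IsNonnegMat B) {z : ℂ} (hz : z ∈ slitPlane) :
    moebius (C * B) z = moebius C (moebius B z) := by
  have hd := slitPlane_ne_zero (hB.den_mem hz)
  have hd' := slitPlane_ne_zero (hC.den_mem (hB.moebius_mem hz))
  have hn : moebius B z * moebiusDen B z = (B 0 0 : ℂ) * z + (B 0 1 : ℂ) := div_mul_cancel₀ _ hd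
  have hB' : moebiusDen B z = (B 1 0 : ℂ) * z + (B 1 1 : ℂ) := rfl
  rw [moebius.eq_1 (C * B), hB.den_mul hz, moebius.eq_1 C, div_eq_div_iff (mul_ne_zero hd' hd) hd']
  simp only [Matrix.mul_apply, Fin.sum_univ_two]
  push_cast
  linear_combination (-moebiusDen C (moebius B z) * (C 0 0 : ℂ)) * hn -
    moebiusDen C (moebius B z) * (C 0 1 : ℂ) * hB'

/-- The powers multiply without a branch factor because the imaginary part of a denominator cz + d
is c times that of z, with c ≥ 0: the denominators of B and CB never lie in opposite open half
planes. -/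
theorem slash_mul (hC : IsNonnegMat C) (hB : IsNonnegMat B) {z : ℂ} (hz : z ∈ slitPlane)
    (s : ℂ) (φ : ℂ → ℂ) :
    slash s φ (C * B) z =
      ((|B.det| : ℤ) : ℂ) ^ s * moebiusDen B z ^ (-2 * s) * slash s φ C (moebius B z) := by
  have im_den : ∀ A : IntMat, (moebiusDen A z).im = A 1 0 * z.im := fun A => by
    simp [moebiusDen]
  have hCB := hC.mul hB
  have e : (moebiusDen C (moebius B z) * moebiusDen B z) ^ (-2 * s) = _ :=
    mul_cpow_of_im (hC.den_mem (hB.moebius_mem hz)) (hB.den_mem hz)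
      (by rw [← hB.den_mul hz]; exact hCB.den_mem hz)
      (fun h => by
        rw [← hB.den_mul hz, im_den]
        rw [im_den] at h
        have : (0 : ℝ) ≤ B 1 0 := by exact_mod_cast hB.nonneg 1 0
        have : (0 : ℝ) ≤ (C * B) 1 0 := by exact_mod_cast hCB.nonneg 1 0
        exact mul_nonneg this (pos_of_mul_pos_right h (by assumption)).le)
      (fun h => by
        rw [← hB.den_mul hz, im_den]
        rw [im_den] at h
        have h0 : (0 : ℝ) ≤ B 1 0 := by exact_mod_cast hB.nonneg 1 0
        have : (0 : ℝ) ≤ (C * B) 1 0 := by exact_mod_cast hCB.nonneg 1 0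
        exact mul_nonpos_of_nonneg_of_nonpos this (neg_of_mul_neg_right h h0).le) (-2 * s)
  have ed : ((|(C * B).det| : ℤ) : ℂ) ^ s =
      ((|C.det| : ℤ) : ℂ) ^ s * ((|B.det| : ℤ) : ℂ) ^ s := by
    have := mul_cpow_ofReal_nonneg (a := ((|C.det| : ℤ) : ℝ)) (b := ((|B.det| : ℤ) : ℝ))
      (by positivity) (by positivity) s
    rw [Matrix.det_mul, abs_mul]
    simpa only [ofReal_intCast, Int.cast_mul] using this
  rw [slash_eq, slash_eq, hB.den_mul hz, hC.moebius_mul hB hz, e, ed]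
  ring

theorem differentiableOn_slash (hA : IsNonnegMat A) (s : ℂ) {φ : ℂ → ℂ}
    (hφ : DifferentiableOn ℂ φ slitPlane) : DifferentiableOn ℂ (slash s φ A) slitPlane := by
  have hd : DifferentiableOn ℂ (moebiusDen A) slitPlane := by
    unfold moebiusDen
    fun_prop
  have hm : DifferentiableOn ℂ (moebius A) slitPlane :=
    DifferentiableOn.div (by fun_prop) hd fun z hz => slitPlane_ne_zero (hA.den_mem hz)
  exact ((hd.cpow_const fun z hz => hA.den_mem hz).const_mul _).mul
    (hφ.comp hm fun z hz => hA.moebius_mem hz)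

end IsNonnegMat

/-! ### The Lewis equation as a three-term relation. -/

/-- The translation `z ↦ z + 1`. -/
def matU : IntMat := !![1, 1; 0, 1]

/-- The transpose of the translation. -/
def matV : IntMat := !![1, 0; 1, 1]

/-- The inversion `z ↦ 1 / z`. -/
def matM : IntMat := !![0, 1; 1, 0]

theorem isNonnegMat_matU : IsNonnegMat matU :=
  ⟨fun i j => by fin_cases i <;> fin_cases j <;> simp [matU], by simp [matU]⟩

theorem isNonnegMat_matV : IsNonnegMat matV :=
  ⟨fun i j => by fin_cases i <;> fin_cases j <;> simp [matV], by simp [matV]⟩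

theorem isNonnegMat_matM : IsNonnegMat matM :=
  ⟨fun i j => by fin_cases i <;> fin_cases j <;> simp [matM], by simp [matM]⟩

theorem slash_matU (s : ℂ) (φ : ℂ → ℂ) (z : ℂ) : slash s φ matU z = φ (z + 1) := by
  simp [slash, matU]

theorem slash_matM (s : ℂ) (φ : ℂ → ℂ) (z : ℂ) :
    slash s φ matM z = z ^ (-2 * s) * φ (1 / z) := by
  simp [slash, matM]

theorem slash_matM_mul_matV (s : ℂ) (φ : ℂ → ℂ) {z : ℂ} (hz : z ≠ 0) :
    slash s φ (matM * matV) z = z ^ (-2 * s) * φ (1 + 1 / z) := by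
  have : (z + 1) / z = 1 + z⁻¹ := by field_simp
  simp [slash, matM, matV, this]

namespace IsLewisSolution

variable {lam s : ℂ} {φ : ℂ → ℂ}

/-- The equations at z and at 1/z contain the same two values φ(z + 1) and φ(1 + 1/z), with the
roles exchanged; λ² = 1 matches the coefficients. -/
theorem eq_slash_matM (hφ : IsLewisSolution lam s φ) (hlam : lam * lam = 1) {z : ℂ}
    (hz : z ∈ slitPlane) : lam * slash s φ matM z = φ z := by
  have hz0 := slitPlane_ne_zero hz
  have hi : z⁻¹ ∈ slitPlane := by
    simpa [moebius, moebiusDen, matM] using isNonnegMat_matM.moebius_mem hz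
  have e1 := hφ.equation z hz
  have e2 := hφ.equation z⁻¹ hi
  rw [slash_matM, e1]
  simp only [one_div, inv_inv] at e2 ⊢
  rw [e2, inv_cpow _ _ (mem_slitPlane_iff_arg.1 hz).1, add_comm 1 z, add_comm 1 z⁻¹]
  have h0 : z ^ (-2 * s) ≠ 0 := by simp [cpow_eq_zero_iff, hz0]
  have := mul_inv_cancel₀ h0
  linear_combination φ (z + 1) * (lam * lam * this + hlam)

theorem slash_matM_mul (hφ : IsLewisSolution lam s φ) (hlam : lam * lam = 1) {B : IntMat}
    (hB : IsNonnegMat B) {z : ℂ} (hz : z ∈ slitPlane) :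
    lam * slash s φ (matM * B) z = slash s φ B z := by
  rw [isNonnegMat_matM.slash_mul hB hz, slash_eq s φ B, ← hφ.eq_slash_matM hlam (hB.moebius_mem hz)]
  ring

/-- The invariance under M turns the V-term into λ times the MV-term, and MV acts by z ↦ 1 + 1/z. -/
theorem slash_three_term (hφ : IsLewisSolution lam s φ) (hlam : lam * lam = 1) {B : IntMat}
    (hB : IsNonnegMat B) {z : ℂ} (hz : z ∈ slitPlane) :
    slash s φ B z = slash s φ (matU * B) z + slash s φ (matV * B) z := by
  rw [← hφ.slash_matM_mul hlam (isNonnegMat_matV.mul hB) hz, ← Matrix.mul_assoc,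
    isNonnegMat_matU.slash_mul hB hz,
    (isNonnegMat_matM.mul isNonnegMat_matV).slash_mul hB hz, slash_matU,
    slash_matM_mul_matV _ _ (slitPlane_ne_zero (hB.moebius_mem hz)), slash_eq,
    hφ.equation _ (hB.moebius_mem hz)]
  ring

end IsLewisSolution

/-! ### Primitivity and its invariance under unimodular factors. -/

theorem isPrimitiveMat_iff {A : IntMat} :
    IsPrimitiveMat A ↔ ∀ k : ℕ, (∀ i j, (k : ℤ) ∣ A i j) → k = 1 := by
  have key : ∀ k : ℕ, k ∣ Nat.gcd (Int.gcd (A 0 0) (A 0 1)) (Int.gcd (A 1 0) (A 1 1)) ↔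
      ∀ i j, (k : ℤ) ∣ A i j := fun k => by
    simp [Nat.dvd_gcd_iff, Fin.forall_fin_two, Int.natCast_dvd, Int.gcd]
  constructor
  · intro h k hk
    rw [← key, h] at hk
    exact Nat.dvd_one.1 hk
  · intro h
    exact h _ ((key _).1 dvd_rfl)

theorem IsPrimitiveMat.of_mul_left {A B : IntMat} (h : IsPrimitiveMat (A * B)) :
    IsPrimitiveMat A := by
  rw [isPrimitiveMat_iff] at h ⊢
  refine fun k hk => h k fun i j => ?_
  rw [Matrix.mul_apply]
  exact Finset.dvd_sum fun l _ => (hk _ _).mul_right _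

theorem IsPrimitiveMat.of_mul_right {A B : IntMat} (h : IsPrimitiveMat (A * B)) :
    IsPrimitiveMat B := by
  rw [isPrimitiveMat_iff] at h ⊢
  refine fun k hk => h k fun i j => ?_
  rw [Matrix.mul_apply]
  exact Finset.dvd_sum fun l _ => (hk _ _).mul_left _

theorem isPrimitiveMat_mul_right_iff {A g g' : IntMat} (hg : g * g' = 1) :
    IsPrimitiveMat (A * g) ↔ IsPrimitiveMat A :=
  ⟨.of_mul_left, fun h => .of_mul_left (B := g') (by rwa [Matrix.mul_assoc, hg, Matrix.mul_one])⟩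

theorem isPrimitiveMat_mul_left_iff {A g g' : IntMat} (hg : g' * g = 1) :
    IsPrimitiveMat (g * A) ↔ IsPrimitiveMat A :=
  ⟨.of_mul_right, fun h => .of_mul_right (A := g') (by
    rwa [← Matrix.mul_assoc, hg, Matrix.one_mul])⟩

theorem isPrimitiveMat_transpose {A : IntMat} :
    IsPrimitiveMat A.transpose ↔ IsPrimitiveMat A := by
  simp only [isPrimitiveMat_iff, Matrix.transpose_apply]
  exact forall_congr' fun k => imp_congr_left forall_comm

/-! ### Splitting U and V off nonnegative matrices. -/

theorem det_of_mem_matS {n : ℕ} {A : IntMat} (h : A ∈ matS n) : A.det = n := by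
  rw [Matrix.det_fin_two]
  exact h.2.2.2.2

theorem isNonnegMat_of_mem_matS {n : ℕ} (hn : 0 < n) {A : IntMat} (h : A ∈ matS n) :
    IsNonnegMat A where
  nonneg i j := by
    obtain ⟨h1, h2, h3, h4, -⟩ := h
    fin_cases i <;> fin_cases j <;> simp <;> omega
  det_ne := by
    rw [det_of_mem_matS h]
    exact_mod_cast hn.ne'

/-- The set of the primitive matrices in `S_n`. -/
def primS (n : ℕ) : Set IntMat := {A ∈ matS n | IsPrimitiveMat A}

theorem primS_finite (n : ℕ) : (primS n).Finite := primitive_finite n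

/-- The set of the transposes of the primitive matrices in `S_n`. -/
def primSTranspose (n : ℕ) : Set IntMat := {A | A.transpose ∈ primS n}

theorem primSTranspose_finite (n : ℕ) : (primSTranspose n).Finite :=
  (primitive_finite n).preimage Matrix.transpose_injective.injOn

/-- The set of the primitive matrices of determinant `n` with nonnegative entries. -/
def primN (n : ℕ) : Set IntMat := {A | (∀ i j, 0 ≤ A i j) ∧ A.det = n ∧ IsPrimitiveMat A}

/-- The inverse of the translation. -/
def matUInv : IntMat := !![1, -1; 0, 1]

/-- The inverse of the transpose of the translation. -/
def matVInv : IntMat := !![1, 0; -1, 1]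

theorem matU_mul_inv : matU * matUInv = 1 := by decide
theorem matUInv_mul : matUInv * matU = 1 := by decide
theorem matV_mul_inv : matV * matVInv = 1 := by decide
theorem matVInv_mul : matVInv * matV = 1 := by decide
theorem matUInv_det : matUInv.det = 1 := by decide
theorem matVInv_det : matVInv.det = 1 := by decide
theorem matM_mul_self : matM * matM = 1 := by decide

open Classical in
/-- The integer valued indicator function of a set of matrices. -/
noncomputable def ind (X : Set IntMat) (A : IntMat) : ℤ := if A ∈ X then 1 else 0

theorem mem_primS {n : ℕ} {A : IntMat} : A ∈ primS n ↔ A ∈ matS n ∧ IsPrimitiveMat A := Iff.rfl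

theorem mem_primN {n : ℕ} {A : IntMat} :
    A ∈ primN n ↔ (∀ i j, 0 ≤ A i j) ∧ A.det = n ∧ IsPrimitiveMat A := Iff.rfl

theorem mem_matS {n : ℕ} {A : IntMat} :
    A ∈ matS n ↔ A 1 0 < A 0 0 ∧ 0 ≤ A 1 0 ∧ A 0 1 < A 1 1 ∧ 0 ≤ A 0 1 ∧
      A 0 0 * A 1 1 - A 0 1 * A 1 0 = n := Iff.rfl

theorem ind_primS {n : ℕ} (hn : 0 < n) (B : IntMat) :
    ind (primS n) B =
      ind (primN n) B - ind (primN n) (matUInv * B) - ind (primN n) (matVInv * B) := by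
  classical
  by_cases hB : B.det = n ∧ IsPrimitiveMat B
  · have h1 : (matUInv * B).det = n ∧ IsPrimitiveMat (matUInv * B) :=
      ⟨by rw [Matrix.det_mul, hB.1, matUInv_det, one_mul],
        (isPrimitiveMat_mul_left_iff matU_mul_inv).2 hB.2⟩
    have h2 : (matVInv * B).det = n ∧ IsPrimitiveMat (matVInv * B) :=
      ⟨by rw [Matrix.det_mul, hB.1, matVInv_det, one_mul],
        (isPrimitiveMat_mul_left_iff matV_mul_inv).2 hB.2⟩
    have hd := hB.1
    rw [Matrix.det_fin_two] at hd
    have hn' : (0 : ℤ) < n := by exact_mod_cast hn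
    -- Positivity of the determinant leaves only one kind of incomparable rows, a > c and d > b; it
    -- also excludes equal rows, so U and V cannot both be split off.
    have e1 : ¬ (0 ≤ B 0 0 ∧ 0 ≤ B 1 1 ∧ B 0 0 < B 1 0 ∧ B 1 1 < B 0 1) := by
      rintro ⟨i1, i2, i3, i4⟩
      nlinarith
    have e2 : ¬ (B 0 0 = B 1 0 ∧ B 0 1 = B 1 1) := by
      rintro ⟨i1, i2⟩
      rw [i1, i2] at hd
      linarith
    have hU : matUInv * B = !![B 0 0 - B 1 0, B 0 1 - B 1 1; B 1 0, B 1 1] := by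
      ext i j
      rw [Matrix.mul_apply, Fin.sum_univ_two]
      fin_cases i <;> fin_cases j <;> simp [matUInv, sub_eq_add_neg]
    have hV : matVInv * B = !![B 0 0, B 0 1; B 1 0 - B 0 0, B 1 1 - B 0 1] := by
      ext i j
      rw [Matrix.mul_apply, Fin.sum_univ_two]
      fin_cases i <;> fin_cases j <;> simp [matVInv, neg_add_eq_sub]
    simp only [ind, mem_primS, mem_primN, h1, h2, hB, and_true, mem_matS, hd]
    simp only [hU, hV, Fin.forall_fin_two, Matrix.of_apply, Matrix.cons_val_zero,
      Matrix.cons_val_one, Matrix.cons_val_fin_one]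
    split_ifs <;> omega
  · have h1 : ¬ ((matUInv * B).det = n ∧ IsPrimitiveMat (matUInv * B)) := by
      rwa [isPrimitiveMat_mul_left_iff matU_mul_inv, Matrix.det_mul, matUInv_det,
        one_mul]
    have h2 : ¬ ((matVInv * B).det = n ∧ IsPrimitiveMat (matVInv * B)) := by
      rwa [isPrimitiveMat_mul_left_iff matV_mul_inv, Matrix.det_mul, matVInv_det,
        one_mul]
    have h3 : B ∉ primS n := fun h => hB ⟨det_of_mem_matS h.1, h.2⟩
    simp only [ind, mem_primN, h1, h2, hB, h3, and_false, if_false, sub_zero]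

theorem ind_primSTranspose {n : ℕ} (hn : 0 < n) (B : IntMat) :
    ind (primSTranspose n) B =
      ind (primN n) B - ind (primN n) (B * matUInv) - ind (primN n) (B * matVInv) := by
  classical
  have tr : ∀ C, ind (primN n) C.transpose = ind (primN n) C := fun C => by
    have : C.transpose ∈ primN n ↔ C ∈ primN n := by
      rw [mem_primN, mem_primN, Matrix.det_transpose, isPrimitiveMat_transpose]
      exact and_congr_left' forall_comm
    simp only [ind, this]
  have h := ind_primS hn B.transpose
  have hu : matUInv * B.transpose = (B * matVInv).transpose := by
    rw [Matrix.transpose_mul]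
    congr 1
    decide
  have hv : matVInv * B.transpose = (B * matUInv).transpose := by
    rw [Matrix.transpose_mul]
    congr 1
    decide
  rw [hu, hv, tr, tr, tr] at h
  rw [sub_right_comm, ← h]
  rfl

/-- Both sides are the coefficient of B in (1 - U - V)N(1 - U - V). -/
theorem ind_mul_comm {n : ℕ} (hn : 0 < n) (B : IntMat) :
    ind (primS n) B - ind (primS n) (B * matUInv) - ind (primS n) (B * matVInv) =
      ind (primSTranspose n) B - ind (primSTranspose n) (matUInv * B) -
        ind (primSTranspose n) (matVInv * B) := by
  simp only [ind_primS hn, ind_primSTranspose hn, Matrix.mul_assoc]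
  ring

/-! ### From indicator functions to finite formal sums. -/

/-- The formal sum of the elements of a finite set of matrices. -/
noncomputable def formalSum (X : Set IntMat) (hX : X.Finite) : IntMat →₀ ℤ :=
  ∑ A ∈ hX.toFinset, Finsupp.single A 1

theorem formalSum_apply {X : Set IntMat} (hX : X.Finite) (B : IntMat) :
    formalSum X hX B = ind X B := by
  classical
  simp [formalSum, ind, Finsupp.finsetSum_apply, Finsupp.single_apply]

theorem linearCombination_formalSum {X : Set IntMat} (hX : X.Finite) (f : IntMat → ℂ) :
    Finsupp.linearCombination ℤ f (formalSum X hX) = ∑ A ∈ hX.toFinset, f A := by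
  simp [formalSum]

theorem mapDomain_mul_right_apply {g g' : IntMat} (h : g * g' = 1) (h' : g' * g = 1)
    (R : IntMat →₀ ℤ) (B : IntMat) :
    R.mapDomain (· * g) B = R (B * g') := by
  have hi : Function.Injective (· * g : IntMat → IntMat) := fun A C hAC => by
    simpa [Matrix.mul_assoc, h] using congrArg (· * g') hAC
  have := Finsupp.mapDomain_apply hi R (B * g')
  simpa only [Matrix.mul_assoc, h', Matrix.mul_one] using this

theorem mapDomain_mul_left_apply {g g' : IntMat} (h : g * g' = 1) (h' : g' * g = 1)
    (R : IntMat →₀ ℤ) (B : IntMat) :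
    R.mapDomain (g * ·) B = R (g' * B) := by
  have hi : Function.Injective (g * · : IntMat → IntMat) := fun A C hAC => by
    simpa [← Matrix.mul_assoc, h'] using congrArg (g' * ·) hAC
  have := Finsupp.mapDomain_apply hi R (g' * B)
  simpa only [← Matrix.mul_assoc, h, Matrix.one_mul] using this

theorem sum_primS_sub {n : ℕ} (hn : 0 < n) (f : IntMat → ℂ) :
    ∑ A ∈ (primS_finite n).toFinset, (f A - f (A * matU) - f (A * matV)) =
      ∑ A ∈ (primSTranspose_finite n).toFinset, (f A - f (matU * A) - f (matV * A)) := by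
  set R := formalSum (primS n) (primS_finite n) with hR
  set R' := formalSum (primSTranspose n) (primSTranspose_finite n) with hR'
  have key : R - R.mapDomain (· * matU) - R.mapDomain (· * matV) =
      R' - R'.mapDomain (matU * ·) - R'.mapDomain (matV * ·) := by
    ext1 B
    simp only [Finsupp.sub_apply, mapDomain_mul_right_apply matU_mul_inv matUInv_mul,
      mapDomain_mul_right_apply matV_mul_inv matVInv_mul,
      mapDomain_mul_left_apply matU_mul_inv matUInv_mul,
      mapDomain_mul_left_apply matV_mul_inv matVInv_mul, hR, hR', formalSum_apply]
    exact ind_mul_comm hn B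
  have := congrArg (Finsupp.linearCombination ℤ f) key
  simpa only [map_sub, Finsupp.linearCombination_mapDomain, hR, hR', linearCombination_formalSum,
    ← Finset.sum_sub_distrib, Function.comp_apply] using this

/-! ### The transformed function solves the Lewis equation. -/

theorem slashSum_eq_linearCombination (s : ℂ) (φ : ℂ → ℂ) (R : IntMat →₀ ℤ) (z : ℂ) :
    slashSum s φ R z = Finsupp.linearCombination ℤ (fun A => slash s φ A z) R := by
  simp [slashSum, Finsupp.linearCombination_apply]

theorem slashSum_tildeT (n : ℕ) (s : ℂ) (φ : ℂ → ℂ) (z : ℂ) :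
    slashSum s φ (tildeT n) z = ∑ A ∈ (primS_finite n).toFinset, slash s φ A z := by
  rw [slashSum_eq_linearCombination, tildeT]
  exact linearCombination_formalSum _ _

theorem matM_conj_mem_primS {n : ℕ} {A : IntMat} (hA : A ∈ primS n) :
    matM * A * matM ∈ primS n := by
  refine ⟨?_, by rw [isPrimitiveMat_mul_right_iff matM_mul_self,
    isPrimitiveMat_mul_left_iff matM_mul_self]; exact hA.2⟩
  obtain ⟨⟨h1, h2, h3, h4, h5⟩, -⟩ := hA
  have e : matM * A * matM = !![A 1 1, A 1 0; A 0 1, A 0 0] := by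
    ext i j
    simp only [Matrix.mul_apply, Fin.sum_univ_two]
    fin_cases i <;> fin_cases j <;> simp [matM]
  rw [e]
  refine ⟨h3, h4, h1, h2, ?_⟩
  rw [← h5]
  simp only [Matrix.of_apply, Matrix.cons_val_zero, Matrix.cons_val_one, Matrix.cons_val_fin_one]
  ring

theorem sum_primS_conj (n : ℕ) (f : IntMat → ℂ) :
    ∑ A ∈ (primS_finite n).toFinset, f (matM * A * matM) =
      ∑ A ∈ (primS_finite n).toFinset, f A := by
  have inv : ∀ A : IntMat, matM * (matM * A * matM) * matM = A := fun A => by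
    have : matM * (matM * A * matM) * matM = (matM * matM) * A * (matM * matM) := by
      simp only [Matrix.mul_assoc]
    rw [this, matM_mul_self, Matrix.one_mul, Matrix.mul_one]
  refine Finset.sum_nbij' (fun A => matM * A * matM) (fun A => matM * A * matM) ?_ ?_
    (fun A _ => inv A) (fun A _ => inv A) fun A _ => rfl
  all_goals
    intro A hA
    rw [Set.Finite.mem_toFinset] at hA ⊢
    exact matM_conj_mem_primS hA

theorem isLewisSolution_slashSum_tildeT {n : ℕ} (hn : 0 < n) {lam s : ℂ} (hlam : lam * lam = 1)
    {φ : ℂ → ℂ} (hφ : IsLewisSolution lam s φ) :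
    IsLewisSolution lam s (slashSum s φ (tildeT n)) := by
  have nonneg : ∀ A ∈ (primS_finite n).toFinset, IsNonnegMat A := fun A hA =>
    isNonnegMat_of_mem_matS hn ((primS_finite n).mem_toFinset.1 hA).1
  refine ⟨?_, fun z hz => ?_⟩
  · rw [show slashSum s φ (tildeT n) = fun z => ∑ A ∈ (primS_finite n).toFinset, slash s φ A z
      from funext (slashSum_tildeT n s φ)]
    exact DifferentiableOn.fun_sum fun A hA =>
      (nonneg A hA).differentiableOn_slash s hφ.holomorphic
  · have hz0 := slitPlane_ne_zero hz
    have hMV := isNonnegMat_matM.mul isNonnegMat_matV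
    have eU : slashSum s φ (tildeT n) (z + 1) =
        ∑ A ∈ (primS_finite n).toFinset, slash s φ (A * matU) z := by
      rw [slashSum_tildeT]
      refine Finset.sum_congr rfl fun A hA => ?_
      rw [(nonneg A hA).slash_mul isNonnegMat_matU hz]
      simp [matU, moebiusDen, moebius]
    have eV : lam * z ^ (-2 * s) * slashSum s φ (tildeT n) (1 + 1 / z) =
        ∑ A ∈ (primS_finite n).toFinset, slash s φ (A * matV) z := by
      -- After replacing A by MAM, the leftmost M is absorbed at the cost of λ, and the remaining
      -- A(MV) produces the argument 1 + 1/z.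
      rw [slashSum_tildeT, ← sum_primS_conj n fun A => slash s φ (A * matV) z, Finset.mul_sum]
      refine Finset.sum_congr rfl fun A hA => ?_
      have hA' := (nonneg A hA).mul hMV
      rw [show matM * A * matM * matV = matM * (A * (matM * matV)) by
          simp only [Matrix.mul_assoc], ← hφ.slash_matM_mul hlam
            (isNonnegMat_matM.mul hA') hz, ← Matrix.mul_assoc, matM_mul_self, Matrix.one_mul,
          (nonneg A hA).slash_mul hMV hz]
      have hm : moebius (matM * matV) z = 1 + 1 / z := by
        have : (z + 1) / z = 1 + z⁻¹ := by field_simp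
        simp [moebius, moebiusDen, matM, matV, this]
      have hd : moebiusDen (matM * matV) z = z := by simp [moebiusDen, matM, matV]
      have hdet : (matM * matV).det = -1 := by decide
      rw [hm, hd, hdet]
      simp [mul_assoc]
    have h := sum_primS_sub hn fun A => slash s φ A z
    -- The sum over the transposes vanishes term by term, by the three-term relation.
    rw [Finset.sum_eq_zero (s := (primSTranspose_finite n).toFinset), Finset.sum_sub_distrib,
      Finset.sum_sub_distrib] at h
    · rw [eU, eV, slashSum_tildeT]
      linear_combination h
    · intro A hA
      have hT := isNonnegMat_of_mem_matS hn ((primSTranspose_finite n).mem_toFinset.1 hA).1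
      have hA' : IsNonnegMat A :=
        ⟨fun i j => hT.nonneg j i, by simpa [Matrix.det_transpose] using hT.det_ne⟩
      rw [hφ.slash_three_term hlam hA' hz]
      ring

/-! ### Partition of a finite set into chains of an iterated map. -/

/-- K is a bijection from S ∖ Y to S ∖ X. Descent of μ makes each forward orbit reach Y, descent of
ν makes each backward orbit reach X, and so every element lies on exactly one chain from X to Y. -/
theorem Finset.sum_sum_iterate_eq_sum {α β : Type*} [AddCommMonoid β] {S X Y : Set α}
    (hS : S.Finite) (hX : X.Finite) (hXS : X ⊆ S) {K : α → α} (μ ν : α → ℕ)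
    (hK : ∀ a ∈ S, a ∉ Y → K a ∈ S ∧ K a ∉ X ∧ μ (K a) < μ a)
    (inj : ∀ a ∈ S, a ∉ Y → ∀ b ∈ S, b ∉ Y → K a = K b → a = b)
    (surj : ∀ b ∈ S, b ∉ X → ∃ a ∈ S, a ∉ Y ∧ K a = b ∧ ν a < ν b) (f : α → β) :
    ∑ x ∈ hX.toFinset, ∑ j ∈ Finset.range (sInf {k | K^[k] x ∈ Y} + 1), f (K^[j] x) =
      ∑ a ∈ hS.toFinset, f a := by
  set len : α → ℕ := fun x => sInf {k | K^[k] x ∈ Y} with hlen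
  have notMem : ∀ {x j}, j < len x → K^[j] x ∉ Y := fun h => Nat.notMem_of_lt_sInf h
  have mem : ∀ {x}, x ∈ S → ∀ j, j ≤ len x → K^[j] x ∈ S := by
    intro x hx j
    induction j with
    | zero => exact fun _ => hx
    | succ j ih =>
      intro h
      rw [Function.iterate_succ_apply']
      exact (hK _ (ih (by omega)) (notMem h)).1
  have nonempty : ∀ m, ∀ a ∈ S, μ a < m → ∃ k, K^[k] a ∈ Y := by
    intro m
    induction m with
    | zero => exact fun a _ h => absurd h (Nat.not_lt_zero _)
    | succ m ih =>
      intro a ha hm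
      by_cases hY : a ∈ Y
      · exact ⟨0, hY⟩
      · obtain ⟨h1, -, h3⟩ := hK a ha hY
        obtain ⟨k, hk⟩ := ih (K a) h1 (by omega)
        exact ⟨k + 1, by rwa [Function.iterate_succ_apply]⟩
  -- The infimum of an empty set is 0, so termination is needed to know that the chain ends in Y.
  have len_mem : ∀ {x}, x ∈ S → K^[len x] x ∈ Y := fun {x} hx =>
    Nat.sInf_mem (s := {k | K^[k] x ∈ Y}) (nonempty _ x hx (Nat.lt_succ_self _))
  have step_notMem : ∀ {x j}, x ∈ S → j + 1 ≤ len x → K^[j + 1] x ∉ X := fun {x j} hx h => by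
    rw [Function.iterate_succ_apply']
    exact (hK _ (mem hx j (by omega)) (notMem h)).2.1
  -- K is cancelled on both sides until one chain is back at its start; the other must be too, as K
  -- never enters X.
  have unique : ∀ j l x y, x ∈ X → y ∈ X → j ≤ len x → l ≤ len y → K^[j] x = K^[l] y →
      j = l ∧ x = y := by
    intro j
    induction j with
    | zero =>
      rintro (_ | l) x y hx hy - h2 h
      · exact ⟨rfl, h⟩
      · exact absurd (show K^[l + 1] y ∈ X from h ▸ hx) (step_notMem (hXS hy) h2)
    | succ j ih =>
      rintro (_ | l) x y hx hy h1 h2 h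
      · exact absurd (show K^[j + 1] x ∈ X from h ▸ hy) (step_notMem (hXS hx) h1)
      · rw [Function.iterate_succ_apply', Function.iterate_succ_apply'] at h
        obtain ⟨rfl, rfl⟩ := ih l x y hx hy (by omega) (by omega)
          (inj _ (mem (hXS hx) j (by omega)) (notMem h1) _ (mem (hXS hy) l (by omega))
            (notMem h2) h)
        exact ⟨rfl, rfl⟩
  have exists_chain : ∀ m, ∀ b ∈ S, ν b < m → ∃ x ∈ X, ∃ j ≤ len x, K^[j] x = b := by
    intro m
    induction m with
    | zero => exact fun a _ h => absurd h (Nat.not_lt_zero _)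
    | succ m ih =>
      intro b hb hm
      by_cases hbX : b ∈ X
      · exact ⟨b, hbX, 0, Nat.zero_le _, rfl⟩
      · obtain ⟨a, ha, haY, rfl, hlt⟩ := surj b hb hbX
        obtain ⟨x, hx, j, hj, rfl⟩ := ih a ha (by omega)
        refine ⟨x, hx, j + 1, ?_, Function.iterate_succ_apply' _ _ _⟩
        -- The predecessor is outside Y, so its chain has not ended yet.
        rcases hj.lt_or_eq with h | h
        · exact h
        · exact absurd (h ▸ len_mem (hXS hx)) haY
  rw [Finset.sum_sigma']
  refine Finset.sum_bij (fun p _ => K^[p.2] p.1) ?_ ?_ ?_ fun _ _ => rfl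
  · rintro ⟨x, j⟩ h
    rw [Finset.mem_sigma, hX.mem_toFinset, Finset.mem_range] at h
    exact hS.mem_toFinset.2 (mem (hXS h.1) j (Nat.lt_succ_iff.1 h.2))
  · rintro ⟨x, j⟩ h ⟨y, l⟩ h' e
    rw [Finset.mem_sigma, hX.mem_toFinset, Finset.mem_range] at h h'
    obtain ⟨h1, h2⟩ := unique j l x y h.1 h'.1 (Nat.lt_succ_iff.1 h.2) (Nat.lt_succ_iff.1 h'.2) e
    subst h1 h2
    rfl
  · intro b hb
    obtain ⟨x, hx, j, hj, h⟩ := exists_chain _ b (hS.mem_toFinset.1 hb) (Nat.lt_succ_self _)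
    exact ⟨⟨x, j⟩, Finset.mem_sigma.2 ⟨hX.mem_toFinset.2 hx, Finset.mem_range.2 (Nat.lt_succ_of_le hj)⟩, h⟩

/-! ### The map K on primitive matrices. -/

theorem mapK_eq {A : IntMat} {m : ℤ} (hb : 0 < A 0 1) (h1 : (m - 1) * A 0 1 < A 1 1)
    (h2 : A 1 1 ≤ m * A 0 1) :
    mapK A = !![-(A 1 0) + m * A 0 0, -(A 1 1) + m * A 0 1; A 0 0, A 0 1] := by
  have hb' : (0 : ℚ) < A 0 1 := by exact_mod_cast hb
  have : ⌈(A 1 1 : ℚ) / (A 0 1 : ℚ)⌉ = m := by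
    rw [Int.ceil_eq_iff, lt_div_iff₀ hb', div_le_iff₀ hb']
    exact ⟨by exact_mod_cast h1, by exact_mod_cast h2⟩
  simp only [mapK, this]

theorem exists_ceil (d : ℤ) {b : ℤ} (hb : 0 < b) : ∃ m : ℤ, (m - 1) * b < d ∧ d ≤ m * b := by
  refine ⟨-((-d) / b), ?_, ?_⟩
  · have := Int.lt_ediv_add_one_mul_self (-d) hb
    linarith
  · have := Int.ediv_mul_le (-d) hb.ne'
    linarith

theorem IsPrimitiveMat.mapK_form {A : IntMat} (h : IsPrimitiveMat A) (m : ℤ) :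
    IsPrimitiveMat !![-(A 1 0) + m * A 0 0, -(A 1 1) + m * A 0 1; A 0 0, A 0 1] := by
  have e : !![-(A 1 0) + m * A 0 0, -(A 1 1) + m * A 0 1; A 0 0, A 0 1] =
      !![m, -1; 1, 0] * A := by
    ext i j
    rw [Matrix.mul_apply, Fin.sum_univ_two]
    fin_cases i <;> fin_cases j <;> simp [add_comm]
  rw [e, isPrimitiveMat_mul_left_iff (g' := !![0, 1; -1, m]) (by
    simp [Matrix.one_fin_two])]
  exact h

theorem IsPrimitiveMat.mapK_inv_form {B : IntMat} (h : IsPrimitiveMat B) (m : ℤ) :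
    IsPrimitiveMat !![B 1 0, B 1 1; -(B 0 0) + m * B 1 0, -(B 0 1) + m * B 1 1] := by
  have e : !![B 1 0, B 1 1; -(B 0 0) + m * B 1 0, -(B 0 1) + m * B 1 1] =
      !![0, 1; -1, m] * B := by
    ext i j
    rw [Matrix.mul_apply, Fin.sum_univ_two]
    fin_cases i <;> fin_cases j <;> simp
  rw [e, isPrimitiveMat_mul_left_iff (g' := !![m, -1; 1, 0]) (by
    simp [Matrix.one_fin_two])]
  exact h

theorem mem_matY_iff {n : ℕ} {A : IntMat} (hA : A ∈ matS n) : A ∈ matY n ↔ A 0 1 = 0 := by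
  constructor
  · rintro ⟨c, a, -, -, rfl⟩
    rfl
  · intro h
    obtain ⟨h1, h2, h3, h4, h5⟩ := hA
    rw [h, zero_mul, sub_zero] at h5
    obtain ⟨c, hc⟩ := Int.eq_ofNat_of_zero_le (h2.trans h1.le)
    obtain ⟨a, ha⟩ := Int.eq_ofNat_of_zero_le h2
    obtain ⟨d, hd⟩ := Int.eq_ofNat_of_zero_le (h4.trans h3.le)
    rw [hc, hd] at h5
    have h5' : c * d = n := by exact_mod_cast h5
    have hc0 : 0 < c := by omega
    refine ⟨c, a, ⟨d, h5'.symm⟩, by omega, ?_⟩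
    rw [← h5', Nat.mul_div_cancel_left _ hc0, ← hc, ← ha, ← hd, ← h]
    exact Matrix.eta_fin_two A

/-- The upper triangular matrices among the primitive matrices in `S_n`. -/
def primUpper (n : ℕ) : Set IntMat := {A | A ∈ primS n ∧ A 1 0 = 0}

theorem primUpper_finite (n : ℕ) : (primUpper n).Finite :=
  (primS_finite n).subset fun _ h => h.1

/-- The new b is md - type remainder mb - d, which lies in [0, b) by the choice of m. As d > b
forces m ≥ 2, the new upper left entry ma - c exceeds a. -/
theorem mapK_mem_primS {n : ℕ} {A : IntMat} (hA : A ∈ primS n) (hY : A 0 1 ≠ 0) :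
    mapK A ∈ primS n ∧ (mapK A) 1 0 ≠ 0 ∧ (mapK A) 0 1 < A 0 1 := by
  obtain ⟨⟨h1, h2, h3, h4, h5⟩, hp⟩ := hA
  have hb : 0 < A 0 1 := lt_of_le_of_ne h4 hY.symm
  obtain ⟨m, hm1, hm2⟩ := exists_ceil (A 1 1) hb
  have hm : 2 ≤ m := by
    by_contra! hlt
    have : m * A 0 1 ≤ 1 * A 0 1 := mul_le_mul_of_nonneg_right (by omega) h4
    linarith
  rw [mapK_eq hb hm1 hm2]
  have ha : 2 * A 0 0 ≤ m * A 0 0 := mul_le_mul_of_nonneg_right hm (h2.trans h1.le)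
  refine ⟨⟨⟨?_, ?_, ?_, ?_, ?_⟩, hp.mapK_form m⟩, ?_, ?_⟩ <;>
    simp only [Matrix.of_apply, Matrix.cons_val_zero, Matrix.cons_val_one, Matrix.cons_val_fin_one]
  · linarith
  · linarith
  · linarith
  · linarith
  · rw [← h5]
    ring
  · linarith
  · linarith

theorem mapK_injOn {n : ℕ} {A B : IntMat} (hA : A ∈ matS n) (hB : B ∈ matS n)
    (h : mapK A = mapK B) : A = B := by
  obtain ⟨h1, h2, h3, h4, -⟩ := hA
  obtain ⟨i1, i2, i3, i4, -⟩ := hB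
  have ha : A 0 0 = B 0 0 := congrFun (congrFun h 1) 0
  have hb : A 0 1 = B 0 1 := congrFun (congrFun h 1) 1
  have hc := congrFun (congrFun h 0) 0
  have hd := congrFun (congrFun h 0) 1
  simp only [mapK, Matrix.of_apply, Matrix.cons_val_zero, Matrix.cons_val_one,
    Matrix.cons_val_fin_one] at hc hd
  generalize ⌈(A 1 1 : ℚ) / (A 0 1 : ℚ)⌉ = m at hc hd
  generalize ⌈(B 1 1 : ℚ) / (B 0 1 : ℚ)⌉ = l at hc hd
  -- The image shows a and b, and c modulo a; since 0 ≤ c < a this fixes c, then m, then d.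
  have hc' : A 1 0 = B 1 0 := by
    have : A 1 0 ≡ B 1 0 [ZMOD A 0 0] := by
      rw [Int.modEq_iff_dvd]
      refine ⟨l - m, ?_⟩
      rw [← ha] at hc
      linear_combination hc
    rwa [Int.ModEq, Int.emod_eq_of_lt h2 h1, Int.emod_eq_of_lt i2 (ha ▸ i1)] at this
  have hml : m = l := by
    rw [hc', ha] at hc
    exact mul_right_cancel₀ (show B 0 0 ≠ 0 by omega) (add_left_cancel hc)
  have hd' : A 1 1 = B 1 1 := by
    rw [hml, hb] at hd
    linarith
  rw [Matrix.eta_fin_two A, Matrix.eta_fin_two B, ha, hb, hc', hd']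

/-- With m = ⌈a/c⌉ the preimage has lower row (mc - a, md - b). Because 0 ≤ b < d, this m is also
⌈(md - b)/d⌉, the multiplier that K uses. -/
theorem exists_mapK_eq {n : ℕ} {B : IntMat} (hB : B ∈ primS n) (h0 : B 1 0 ≠ 0) :
    ∃ A ∈ primS n, A 0 1 ≠ 0 ∧ mapK A = B ∧ A 1 0 < B 1 0 := by
  obtain ⟨⟨h1, h2, h3, h4, h5⟩, hp⟩ := hB
  have hc : 0 < B 1 0 := lt_of_le_of_ne h2 h0.symm
  obtain ⟨m, hm1, hm2⟩ := exists_ceil (B 0 0) hc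
  have hm : 2 ≤ m := by
    by_contra! hlt
    have : m * B 1 0 ≤ 1 * B 1 0 := mul_le_mul_of_nonneg_right (by omega) h2
    linarith
  have hd : 2 * B 1 1 ≤ m * B 1 1 := mul_le_mul_of_nonneg_right hm (h4.trans h3.le)
  refine ⟨!![B 1 0, B 1 1; -(B 0 0) + m * B 1 0, -(B 0 1) + m * B 1 1], ⟨⟨?_, ?_, ?_, ?_, ?_⟩, ?_⟩,
    ?_, ?_, ?_⟩
  case refine_6 => exact hp.mapK_inv_form m
  case refine_8 =>
    rw [mapK_eq (m := m)]
    · refine .trans ?_ (Matrix.eta_fin_two B).symm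
      simp
    all_goals
      simp only [Matrix.of_apply, Matrix.cons_val_zero, Matrix.cons_val_one,
        Matrix.cons_val_fin_one]
      linarith
  all_goals
    simp only [Matrix.of_apply, Matrix.cons_val_zero, Matrix.cons_val_one, Matrix.cons_val_fin_one]
  · linarith
  · linarith
  · linarith
  · linarith
  · rw [← h5]
    ring
  · omega
  · linarith

theorem sum_chains (n : ℕ) {β : Type*} [AddCommMonoid β] (f : IntMat → β) :
    ∑ x ∈ (primUpper_finite n).toFinset,
        ∑ j ∈ Finset.range (sInf {k | mapK^[k] x ∈ matY n} + 1), f (mapK^[j] x) =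
      ∑ A ∈ (primS_finite n).toFinset, f A := by
  refine Finset.sum_sum_iterate_eq_sum (primS_finite n) (primUpper_finite n) (fun _ h => h.1)
    (fun A => (A 0 1).toNat) (fun A => (A 1 0).toNat) ?_ ?_ ?_ f
  · intro A hA hY
    rw [mem_matY_iff hA.1] at hY
    obtain ⟨h1, h2, h3⟩ := mapK_mem_primS hA hY
    have := hA.1.2.2.2.1
    have := h1.1.2.2.2.1
    exact ⟨h1, fun h => h2 h.2, by omega⟩
  · intro A hA _ B hB _ h
    exact mapK_injOn hA.1 hB.1 h
  · intro B hB hX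
    obtain ⟨A, hA, h0, h, hlt⟩ := exists_mapK_eq hB fun h => hX ⟨hB, h⟩
    have := hA.1.2.1
    exact ⟨A, hA, by rwa [mem_matY_iff hA.1], h, by omega⟩

/-! ### Points modulo n and admissible pairs. -/

/-- Units modulo n surject onto units modulo a divisor d. -/
theorem exists_modEq_isCoprime {d n : ℕ} (hn : 0 < n) (hd : d ∣ n) {x : ℤ}
    (hx : IsCoprime x (d : ℤ)) : ∃ k : ℤ, k ≡ x [ZMOD d] ∧ IsCoprime k (n : ℤ) := by
  have : NeZero n := ⟨hn.ne'⟩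
  obtain ⟨u, hu⟩ := ZMod.unitsMap_surjective hd ((ZMod.coe_int_isUnit_iff_isCoprime x d).2
    hx.symm).unit
  obtain ⟨k, hk⟩ := ZMod.intCast_surjective (u : ZMod n)
  refine ⟨k, ?_, ((ZMod.coe_int_isUnit_iff_isCoprime k n).1 (hk ▸ u.isUnit)).symm⟩
  rw [← ZMod.intCast_eq_intCast_iff]
  have := congrArg Units.val hu
  rw [ZMod.unitsMap_val, ← hk, IsUnit.unit_spec, ZMod.cast_intCast hd] at this
  exact this

theorem point_eq_iff {n : ℕ} {x y x' y' : ℤ} : point n x y = point n x' y' ↔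
    ∃ k : ℤ, IsCoprime k (n : ℤ) ∧ k * x ≡ x' [ZMOD n] ∧ k * y ≡ y' [ZMOD n] := by
  simp only [Int.isCoprime_iff_gcd_eq_one]
  exact Quotient.eq (r := pointSetoid n)

theorem mem_indexSet_iff {n : ℕ} {i : PointSpace n} :
    i ∈ indexSet n ↔ ∃ x y : ℤ, IsCoprime x y ∧ point n x y = i := by
  constructor
  · rintro ⟨g, rfl⟩
    refine ⟨g.1 1 0, g.1 1 1, ?_, rfl⟩
    have h : IsUnit g.1.det := (Matrix.isUnit_iff_isUnit_det _).1 g.isUnit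
    rw [Matrix.det_fin_two] at h
    obtain ⟨v, hv⟩ := h.exists_right_inv
    exact ⟨-(g.1 0 1) * v, g.1 0 0 * v, by linear_combination hv⟩
  · rintro ⟨x, y, ⟨u, v, huv⟩, rfl⟩
    have h : IsUnit (!![v, -u; x, y] : IntMat) := by
      rw [Matrix.isUnit_iff_isUnit_det, Matrix.det_fin_two_of]
      rw [show v * y - -u * x = 1 by linear_combination huv]
      exact isUnit_one
    exact ⟨h.unit, rfl⟩

/-- These two properties carry the parametrization of `I_n`; the minimality of d(c, b) only selects
a representative. -/
theorem pairD_spec {n : ℕ} {p : ℕ × ℕ} (hp : p ∈ pairSet n) :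
    IsCoprime (p.1 : ℤ) (pairD n p) ∧
      (pairD n p : ℤ) ≡ p.1 + p.2 [ZMOD (n / p.1 : ℕ)] := by
  obtain ⟨-, -, -, k, hk, hg⟩ := hp
  obtain ⟨l, -, hl, h⟩ := Nat.sInf_mem
    (s := {d | ∃ k < p.1, Nat.gcd p.1 (p.2 + k * (n / p.1)) = 1 ∧ d = p.1 + p.2 + k * (n / p.1)})
    ⟨_, k, hk, hg, rfl⟩
  change pairD n p = _ at h
  rw [h]
  constructor
  · rw [Nat.isCoprime_iff_coprime, add_assoc, Nat.coprime_self_add_right]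
    exact hl
  · push_cast
    simp [Int.ModEq]

/-- For d = y + ue and βc + αy = 1 the multiplier 1 + uαe works: it fixes c modulo ce, sends y to d
- uβce, is 1 modulo e, and is prime to c because its product with y is d modulo c. -/
theorem point_eq_of_modEq {c e : ℕ} {y d : ℤ} (hy : IsCoprime (c : ℤ) y) (hd : IsCoprime (c : ℤ) d)
    (h : y ≡ d [ZMOD e]) : point (c * e) c y = point (c * e) c d := by
  obtain ⟨u, hu⟩ := h.dvd
  obtain ⟨β, α, hαβ⟩ := hy
  rw [point_eq_iff]
  have e1 : (1 + u * α * e) * y = d - u * β * (c * e) := by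
    linear_combination (u * e) * hαβ - hu
  refine ⟨1 + u * α * e, ?_, ?_, ?_⟩
  · push_cast
    refine IsCoprime.mul_right ?_ ⟨1, -(u * α), by ring⟩
    refine IsCoprime.of_mul_left_left (y := y) ?_
    rw [e1, show d - u * β * (c * e) = d + c * (-(u * β * e)) by ring]
    exact hd.symm.add_mul_left_left _
  · exact (Int.modEq_iff_dvd.2 ⟨-(u * α), by push_cast; ring⟩)
  · rw [e1]
    exact (Int.modEq_iff_dvd.2 ⟨u * β, by push_cast; ring⟩)

/-- The point determines c as a gcd with n. A multiplier that fixes c modulo n is 1 modulo n/c, so b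
is determined modulo n/c. -/
theorem pairPoint_injOn {n : ℕ} (hn : 0 < n) : Set.InjOn (pairPoint n) (pairSet n) := by
  rintro ⟨c, b⟩ hp ⟨c', b'⟩ hq h
  have h1 := (pairD_spec hp).2
  have h2 := (pairD_spec hq).2
  rw [pairPoint, pairPoint, point_eq_iff] at h
  obtain ⟨k, hk, hc, hd⟩ := h
  simp only at h1 h2 hc hd
  obtain ⟨hc1, hcn, hb, -⟩ := hp
  obtain ⟨hc1', hcn', hb', -⟩ := hq
  simp only at hc1 hcn hb hc1' hcn' hb'
  have hcc : c = c' := by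
    have : Int.gcd (k * c) n = Int.gcd c' n := by
      rw [← Int.gcd_emod, ← Int.gcd_emod c']
      exact congrArg (Int.gcd · n) hc
    rw [Int.gcd_mul_right_left_of_gcd_eq_one (Int.isCoprime_iff_gcd_eq_one.1 hk)] at this
    simpa [Int.gcd_natCast_natCast, Nat.gcd_eq_left hcn, Nat.gcd_eq_left hcn'] using this
  subst hcc
  obtain ⟨e, rfl⟩ := hcn
  rw [Nat.mul_div_cancel_left _ hc1] at h1 h2 hb hb'
  have hk1 : k ≡ 1 [ZMOD e] := by
    rw [Int.modEq_iff_dvd] at hc ⊢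
    refine (mul_dvd_mul_iff_left (a := (c : ℤ)) (by exact_mod_cast (by omega : c ≠ 0))).1 ?_
    rw [← Nat.cast_mul, show (c : ℤ) * (1 - k) = c - k * c by ring]
    exact hc
  have hd' : k * (pairD (c * e) (c, b) : ℤ) ≡ pairD (c * e) (c, b') [ZMOD e] :=
    hd.of_dvd ⟨c, by push_cast; ring⟩
  have := (h1.symm.trans ((by simpa using (hk1.mul_right _).symm) : _ ≡ _ [ZMOD e])).trans
    (hd'.trans h2)
  have := Int.ModEq.add_left_cancel' _ this
  have := Nat.ModEq.eq_of_lt_of_lt (Int.natCast_modEq_iff.1 this) hb hb'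
  rw [this]

theorem pairPoint_bijOn {n : ℕ} (hn : 0 < n) :
    Set.BijOn (pairPoint n) (pairSet n) (indexSet n) := by
  refine ⟨fun p hp => mem_indexSet_iff.2 ⟨_, _, (pairD_spec hp).1, rfl⟩, pairPoint_injOn hn, ?_⟩
  intro i hi
  obtain ⟨x, y, hxy, rfl⟩ := mem_indexSet_iff.1 hi
  obtain ⟨c, hc⟩ : ∃ c, c = Int.gcd x n := ⟨_, rfl⟩
  have hcx : (c : ℤ) ∣ x := hc ▸ Int.gcd_dvd_left ..
  have hcn : c ∣ n := Int.natCast_dvd_natCast.1 (hc ▸ Int.gcd_dvd_right ..)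
  have hc0 : 0 < c := Nat.pos_of_dvd_of_pos hcn hn
  obtain ⟨e, rfl⟩ := hcn
  obtain ⟨x', rfl⟩ := hcx
  have hx' : IsCoprime x' (e : ℤ) := by
    rw [Int.isCoprime_iff_gcd_eq_one]
    push_cast at hc
    rw [Int.gcd_mul_left, Int.natAbs_natCast] at hc
    exact (Nat.eq_of_mul_eq_mul_left hc0 (by omega)).symm
  have he0 : 0 < e := Nat.pos_of_mul_pos_left hn
  obtain ⟨u, v, huv⟩ := hx'
  -- An inverse of x' modulo e, lifted to a unit modulo n, normalizes the first coordinate to c.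
  obtain ⟨k, hku, hkn⟩ := exists_modEq_isCoprime hn (Dvd.intro_left c rfl)
    (⟨x', v, by linear_combination huv⟩ : IsCoprime u (e : ℤ))
  have hkc : IsCoprime k (c : ℤ) := by
    push_cast at hkn
    exact hkn.of_mul_right_left
  have hy : IsCoprime (c : ℤ) (k * y) := hkc.symm.mul_right hxy.of_mul_left_left
  have hkx : k * x' ≡ 1 [ZMOD e] :=
    (hku.mul_right x').trans (Int.modEq_iff_dvd.2 ⟨v, by linear_combination -huv⟩)
  have e1 : point (c * e) (c * x') y = point (c * e) c (k * y) := by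
    rw [point_eq_iff]
    refine ⟨k, hkn, ?_, rfl⟩
    have := hkx.mul_left' (c := (c : ℤ))
    push_cast
    convert this using 1 <;> ring
  have hne : ((c * e : ℕ) : ℤ) ≠ 0 := by exact_mod_cast hn.ne'
  -- Division of r by e gives b as remainder and the witness of admissibility as quotient; c is
  -- subtracted because d(c, b) contains the summand c.
  obtain ⟨r, hr⟩ := Int.eq_ofNat_of_zero_le (Int.emod_nonneg (k * y - c) hne)
  have hrlt : r < c * e := by
    have := Int.emod_lt_of_pos (k * y - c) (by exact_mod_cast hn : (0 : ℤ) < (c * e : ℕ))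
    rw [hr] at this
    exact_mod_cast this
  have hrm : (r : ℤ) ≡ k * y - c [ZMOD (c * e : ℕ)] := by
    rw [← hr]
    exact Int.mod_modEq _ _
  have hgr : Nat.gcd c r = 1 := by
    have : (r : ℤ) ≡ k * y - c [ZMOD c] := hrm.of_dvd ⟨e, by push_cast; ring⟩
    obtain ⟨w, hw⟩ := this.symm.dvd
    have : (r : ℤ) = k * y + c * (w - 1) := by linear_combination hw
    rw [← Nat.coprime_iff_gcd_eq_one, ← Nat.isCoprime_iff_coprime, this]
    exact hy.add_mul_left_right _
  have hp : (c, r % e) ∈ pairSet (c * e) := by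
    refine ⟨hc0, Dvd.intro e rfl, ?_, r / e, ?_, ?_⟩ <;>
      simp only [Nat.mul_div_cancel_left _ hc0]
    · exact Nat.mod_lt _ he0
    · exact Nat.div_lt_of_lt_mul (by rwa [mul_comm])
    · rwa [mul_comm, Nat.mod_add_div]
  refine ⟨_, hp, ?_⟩
  rw [e1]
  obtain ⟨h1, h2⟩ := pairD_spec hp
  refine (point_eq_of_modEq hy h1 ?_).symm
  simp only [Nat.mul_div_cancel_left _ hc0] at h2
  refine .trans ?_ h2.symm
  have : k * y - c ≡ r [ZMOD e] := (hrm.of_dvd ⟨c, by push_cast; ring⟩).symm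
  have := (this.trans (by simp [Int.ModEq] : (r : ℤ) ≡ (r % e : ℕ) [ZMOD e])).add_left c
  simpa using this

/-! ### Admissible pairs and primitive triangular matrices. -/

/-- The upper triangular matrix with rows `(c, b)` and `(0, n / c)`. -/
def pairMat (n : ℕ) (p : ℕ × ℕ) : IntMat := !![(p.1 : ℤ), (p.2 : ℤ); 0, ((n / p.1 : ℕ) : ℤ)]

/-- Primitivity implies admissibility: g = gcd(b, e) is prime to c, and b/g is prime to e/g, so its
class modulo e/g contains an integer prime to c. Reducing the multiplier modulo c gives the range k
< c. -/
theorem exists_lt_gcd_add_mul_eq_one {c b e : ℕ} (hc : 0 < c) (he : 0 < e)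
    (h : ∀ k : ℕ, k ∣ c → k ∣ b → k ∣ e → k = 1) : ∃ k < c, Nat.gcd c (b + k * e) = 1 := by
  obtain ⟨b', hb⟩ := Nat.gcd_dvd_left b e
  obtain ⟨e', he'⟩ := Nat.gcd_dvd_right b e
  have hg : 0 < Nat.gcd b e := Nat.gcd_pos_of_pos_right _ he
  have hcop : Nat.Coprime b' e' := by
    have := Nat.gcd_mul_left (Nat.gcd b e) b' e'
    rw [← hb, ← he'] at this
    exact (Nat.eq_of_mul_eq_mul_left hg (by omega)).symm
  have hcg : Nat.Coprime c (Nat.gcd b e) :=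
    h _ (Nat.gcd_dvd_left ..) ((Nat.gcd_dvd_right ..).trans (Nat.gcd_dvd_left ..))
      ((Nat.gcd_dvd_right ..).trans (Nat.gcd_dvd_right ..))
  have he0 : 0 < e' := Nat.pos_of_ne_zero fun h0 => by simp [h0] at he'; omega
  obtain ⟨k, hk, hkc⟩ := exists_modEq_isCoprime (Nat.mul_pos hc he0) (Dvd.intro_left c rfl)
    (Nat.isCoprime_iff_coprime.2 hcop)
  obtain ⟨m, hm⟩ := hk.symm.dvd
  push_cast at hkc
  obtain ⟨l, hl⟩ := Int.eq_ofNat_of_zero_le (Int.emod_nonneg m (by omega : (c : ℤ) ≠ 0))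
  refine ⟨l, ?_, ?_⟩
  · have := Int.emod_lt_of_pos m (by omega : (0 : ℤ) < c)
    omega
  · have e1 : b + l * e = Nat.gcd b e * (b' + l * e') := by
      rw [mul_add, ← hb, mul_left_comm, ← he']
    rw [← Nat.coprime_iff_gcd_eq_one, e1]
    refine hcg.mul_right ?_
    rw [← Nat.isCoprime_iff_coprime]
    have hm' := Int.emod_add_mul_ediv m c
    have e2 : ((b' + l * e' : ℕ) : ℤ) = k + c * (-(m / c) * e') := by
      push_cast
      rw [← hl]
      linear_combination (-1 : ℤ) * hm + (e' : ℤ) * hm'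
    rw [e2]
    exact hkc.of_mul_right_left.symm.add_mul_left_right _

theorem pairMat_bijOn {n : ℕ} (hn : 0 < n) :
    Set.BijOn (pairMat n) (pairSet n) (primUpper n) := by
  refine ⟨?_, ?_, ?_⟩
  · rintro ⟨c, b⟩ ⟨hc, ⟨e, rfl⟩, hb, k, hk, hg⟩
    simp only at hc hb hk hg
    rw [Nat.mul_div_cancel_left _ hc] at hb hg
    simp only [pairMat, Nat.mul_div_cancel_left _ hc]
    refine ⟨⟨⟨?_, ?_, ?_, ?_, ?_⟩, ?_⟩, rfl⟩
    case refine_6 =>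
      rw [isPrimitiveMat_iff]
      intro m hm
      have h1 : m ∣ c := Int.natCast_dvd_natCast.1 (hm 0 0)
      have h2 : m ∣ b := Int.natCast_dvd_natCast.1 (hm 0 1)
      have h3 : m ∣ e := Int.natCast_dvd_natCast.1 (hm 1 1)
      exact Nat.dvd_one.1 (hg ▸ Nat.dvd_gcd h1 (h2.add (h3.mul_left k)))
    all_goals simp
    · exact hc
    · exact hb
  · rintro ⟨c, b⟩ - ⟨c', b'⟩ - h
    have h1 : (c : ℤ) = c' := congrFun (congrFun h 0) 0
    have h2 : (b : ℤ) = b' := congrFun (congrFun h 0) 1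
    simp only [Prod.mk.injEq]
    omega
  · rintro A ⟨⟨⟨h1, h2, h3, h4, h5⟩, hp⟩, h0⟩
    obtain ⟨c, hc⟩ := Int.eq_ofNat_of_zero_le (h2.trans h1.le)
    obtain ⟨b, hb⟩ := Int.eq_ofNat_of_zero_le h4
    obtain ⟨e, he⟩ := Int.eq_ofNat_of_zero_le (h4.trans h3.le)
    rw [hc, he, h0, mul_zero, sub_zero] at h5
    have h5' : c * e = n := by exact_mod_cast h5
    have hc0 : 0 < c := by omega
    subst h5'
    refine ⟨(c, b), ⟨hc0, Dvd.intro e rfl, ?_, ?_⟩, ?_⟩ <;>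
      simp only [Nat.mul_div_cancel_left _ hc0, pairMat]
    · omega
    · refine exists_lt_gcd_add_mul_eq_one hc0 (by omega) fun k i1 i2 i3 => ?_
      refine isPrimitiveMat_iff.1 hp k ?_
      simp only [Fin.forall_fin_two, hc, hb, he, h0, Int.natCast_dvd_natCast, dvd_zero]
      exact ⟨⟨i1, i2⟩, trivial, i3⟩
    · rw [← hc, ← hb, ← he, ← h0]
      exact (Matrix.eta_fin_two A).symm

/-! ### Equality of the two operators. -/

theorem matA_bijOn {n : ℕ} (hn : 0 < n) : Set.BijOn (matA n) (indexSet n) (primUpper n) := by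
  have h := pairPoint_bijOn hn
  have h' : Set.BijOn (indexPair n) (indexSet n) (pairSet n) :=
    h.invOn_invFunOn.symm.bijOn h.surjOn.mapsTo_invFunOn h.mapsTo
  exact (pairMat_bijOn hn).comp h'

theorem sum_tildePsi {n : ℕ} (hn : 0 < n) :
    ∑ i ∈ (indexSet_finite n hn).toFinset, tildePsi n i = tildeT n := by
  have h := matA_bijOn hn
  refine .trans ?_ (sum_chains n fun A => Finsupp.single A (1 : ℤ))
  refine Finset.sum_bij (fun i _ => matA n i) ?_ ?_ ?_ fun _ _ => rfl
  · intro i hi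
    rw [Set.Finite.mem_toFinset] at hi ⊢
    exact h.mapsTo hi
  · intro i hi j hj hij
    rw [Set.Finite.mem_toFinset] at hi hj
    exact h.injOn hi hj hij
  · intro A hA
    rw [Set.Finite.mem_toFinset] at hA
    obtain ⟨i, hi, e⟩ := h.surjOn hA
    exact ⟨i, (Set.Finite.mem_toFinset _).2 hi, e⟩

theorem tildeH_eq_slashSum_tildeT {n : ℕ} (hn : 0 < n) (s : ℂ) (φ : ℂ → ℂ) :
    tildeH n s φ = slashSum s φ (tildeT n) := by
  funext z
  rw [tildeH, finsum_mem_eq_finite_toFinset_sum _ (indexSet_finite n hn), ← sum_tildePsi hn]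
  simp only [slashSum_eq_linearCombination, map_sum]

theorem theorem8p1 (n : ℕ) (hn : 0 < n) (lam : ℂ) (hlam : lam = 1 ∨ lam = -1) (s : ℂ)
    (φ : ℂ → ℂ) (hφ : IsLewisSolution lam s φ) :
    Set.EqOn (tildeH n s φ) (slashSum s φ (tildeT n)) slitPlane ∧
      IsLewisSolution lam s (slashSum s φ (tildeT n)) := by
  refine ⟨fun z _ => congrFun (tildeH_eq_slashSum_tildeT hn s φ) z,
    isLewisSolution_slashSum_tildeT hn ?_ hφ⟩
  rcases hlam with rfl | rfl <;> norm_num
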